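/- Let $\mathcal A$ be a finite collection of circular arcs and line segments in the plane, each with two distinct endpoints. Say that $\mathcal A$ obeys *Plateau's laws* if (i) any two different curves of $\mathcal A$ meet at most in common endpoints, and (ii) at each endpoint of a curve of $\mathcal A$ exactly three curves meet, pairwise forming angles of $2\pi/3$ there. The *bubbles* of $\mathcal A$ are the connected components of the complement of the union of its curves (including the unbounded component). Fix a constant $\sigma>0$. The collection $\mathcal A$ is a *planar soap bubble cluster* if it obeys Plateau's laws and there is an assignment of a real number (a pressure) to each bubble that satisfies the *Young–Laplace equation*: at every interior point of a curve of $\mathcal A$ of curvature $c\ge 0$ (the inverse of its radius; $c=0$ for a line segment), the pressure of the bubble on the side of the center of curvature minus the pressure of the bubble on the other side equals $\sigma c$ (so the two pressures are equal for a line segment). The *signed curvature* at an endpoint $p$ of a curve of curvature $c$ is $c$ if the curve curves clockwise as it leaves $p$, $-c$ if it curves counterclockwise, and $0$ for a line segment. **Lemma.** For every $\sigma>0$, $\mathcal A$ is a planar soap bubble cluster if and only if it obeys Plateau's laws and, at each endpoint of an arc or segment, the sum of the signed curvatures of the three incoming curves is zero. -/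

import Mathlib

open Set Filter Topology

noncomputable section

namespace SoapBubble

/-- A circular arc or line segment in the plane `ℂ`, traversed at unit speed: it leaves the point
`start` in the unit direction `dir`, has length `len > 0`, and turns with constant oriented
curvature `curv` (positive: counterclockwise, negative: clockwise, zero: a line segment).
The last field says that the curve runs over less than one full turn of its circle, so that it is
a proper arc with two distinct endpoints. -/
structure Arc where
  start : ℂ
  dir : ℂ
  curv : ℝ
  len : ℝ
  norm_dir : ‖dir‖ = 1
  len_pos : 0 < len
  not_closed : |curv| * len < 2 * Real.pi

namespace Arc

/-- The point at arc length `s`.  For `curv = 0` it moves along a line; otherwise it moves along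
the circle with radius `1 / |curv|` and center `start + I * dir / curv`. -/
def point (a : Arc) (s : ℝ) : ℂ :=
  if a.curv = 0 then a.start + s * a.dir
  else a.start + a.dir * ((Complex.exp (Complex.I * a.curv * s) - 1) / (Complex.I * a.curv))

/-- The unit tangent vector at arc length `s` (the derivative of `point`). -/
def tangent (a : Arc) (s : ℝ) : ℂ :=
  a.dir * Complex.exp (Complex.I * a.curv * s)

/-- The unit normal at arc length `s`, pointing to the left of the direction of travel. -/
def leftNormal (a : Arc) (s : ℝ) : ℂ :=
  Complex.I * a.tangent s

/-- The arc as a set of points, endpoints included. -/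
def carrier (a : Arc) : Set ℂ :=
  a.point '' Icc 0 a.len

/-- The endpoint of the arc at its beginning (`false`) or at its end (`true`). -/
def endpoint (a : Arc) : Bool → ℂ
  | false => a.point 0
  | true => a.point a.len

/-- The unit tangent vector of the arc as it leaves the given endpoint. -/
def outgoing (a : Arc) : Bool → ℂ
  | false => a.tangent 0
  | true => -a.tangent a.len

/-- The signed curvature at the given endpoint: the curvature `|curv|` if the arc
curves clockwise as it leaves that endpoint, and its negative if it curves counterclockwise. -/
def signedCurvature (a : Arc) : Bool → ℝ
  | false => -a.curv
  | true => a.curv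

end Arc

variable {ι : Type*}

/-- The union of all the curves of the collection. -/
def figure (A : ι → Arc) : Set ℂ :=
  ⋃ i, (A i).carrier

open Classical in
/-- The ends of curves that are located at the point `v`; the pair `(i, b)` stands for the
end `b` of the `i`-th curve. -/
def endsAt [Fintype ι] (A : ι → Arc) (v : ℂ) : Finset (ι × Bool) :=
  Finset.univ.filter fun e => (A e.1).endpoint e.2 = v

/-- Plateau's laws in the plane, for a finite collection of circular arcs and line segments. -/
structure PlateauLaws [Fintype ι] (A : ι → Arc) : Prop where
  /-- Two different curves meet at most in common endpoints. -/
  noncrossing : ∀ i j, i ≠ j →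
    (A i).carrier ∩ (A j).carrier ⊆ range (A i).endpoint ∩ range (A j).endpoint
  /-- At each endpoint of a curve exactly three curves meet. -/
  three_meet : ∀ i b, (endsAt A ((A i).endpoint b)).card = 3
  /-- Any two of the curves that meet at an endpoint form an angle of `2π/3` there. -/
  angles : ∀ v, ∀ e ∈ endsAt A v, ∀ f ∈ endsAt A v, e ≠ f →
    InnerProductGeometry.angle ((A e.1).outgoing e.2) ((A f.1).outgoing f.2) = 2 * Real.pi / 3

/-- The bubbles: the connected components of the complement of the figure (the unbounded,
outside region included). -/
def Bubble (A : ι → Arc) : Type :=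
  {B : Set ℂ // ∃ z ∈ (figure A)ᶜ, B = connectedComponentIn (figure A)ᶜ z}

/-- `B` is the bubble immediately to the left of the `i`-th curve at arc length `s`. -/
def IsLeftBubble (A : ι → Arc) (i : ι) (s : ℝ) (B : Bubble A) : Prop :=
  ∀ᶠ ε : ℝ in 𝓝[>] 0, (A i).point s + ε * (A i).leftNormal s ∈ B.1

/-- `B` is the bubble immediately to the right of the `i`-th curve at arc length `s`. -/
def IsRightBubble (A : ι → Arc) (i : ι) (s : ℝ) (B : Bubble A) : Prop :=
  ∀ᶠ ε : ℝ in 𝓝[>] 0, (A i).point s - ε * (A i).leftNormal s ∈ B.1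

/-- The Young--Laplace equation with constant of proportionality `σ` for the pressures `p`: at each
interior point of each curve, the pressure difference between the bubbles on the two sides of the
curve is `σ` times the curvature, the higher pressure being on the side of the center of curvature.
(The center is on the left of a curve with `curv > 0`, and on the right if `curv < 0`.) -/
def YoungLaplace (σ : ℝ) (A : ι → Arc) (p : Bubble A → ℝ) : Prop :=
  ∀ i, ∀ s ∈ Ioo 0 (A i).len, ∃ L R : Bubble A,
    IsLeftBubble A i s L ∧ IsRightBubble A i s R ∧ p L - p R = σ * (A i).curv

/-- A planar soap bubble cluster: a finite collection of circular arcs and line segments that obeys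
Plateau's laws, and the Young--Laplace equation for some assignment of pressures to bubbles. -/
def IsSoapBubbleCluster [Fintype ι] (σ : ℝ) (A : ι → Arc) : Prop :=
  PlateauLaws A ∧ ∃ p : Bubble A → ℝ, YoungLaplace σ A p

end SoapBubble

end

/-! Necessity is local. List the three ends at a vertex counterclockwise and orient their curves
outward. Near the vertex the bubble to the left of each curve is the bubble to the right of the next
(`Arc.eventually_left_eq_right`), so the three left-minus-right pressure differences telescope
around the vertex. Each difference is `-σ` times a signed curvature, and `σ ≠ 0` gives the balance
(`YoungLaplace.sum_eq_zero`). The geometric content is that the sector between two curves at angle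
`2π/3` is connected near the vertex (`Arc.exists_radius_sector`).

Sufficiency is global, and the pressure is written down explicitly. Let `Φ(z)` be the sum over the
curves of curvature times `∫ dw / (w - z)`. Differentiating under the integral leaves only endpoint
terms `k (1/(start - z) - 1/(end - z))`; grouped by vertex, they cancel exactly because the signed
curvatures are balanced. Hence `Φ` is constant on each bubble (`Balanced.potential_eq`). By the
Plemelj relation it jumps by `2πi k` across a curve of oriented curvature `k`
(`tendsto_potential_sub`), so `σ Re (Φ / 2πi)` satisfies the Young–Laplace equation. This avoids any
argument about loops of bubbles around vertices. -/

namespace SoapBubble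

/-! ### Elementary geometry of arcs: displacement, tangent, the two sides -/

namespace Arc

/-- The displacement after arc length `u` along the curve of curvature `k` that leaves `0` in the
direction `1`. -/
noncomputable def chord (k u : ℝ) : ℂ :=
  if k = 0 then u else (Complex.exp (Complex.I * k * u) - 1) / (Complex.I * k)

@[simp] lemma chord_zero (k : ℝ) : chord k 0 = 0 := by simp [chord]

lemma chord_add (k s u : ℝ) :
    chord k (s + u) = chord k s + Complex.exp (Complex.I * k * s) * chord k u := by
  unfold chord
  split_ifs with h
  · simp [h]
  · have hk : (k : ℂ) ≠ 0 := by exact_mod_cast h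
    have : Complex.exp (Complex.I * k * (s + u : ℝ))
        = Complex.exp (Complex.I * k * s) * Complex.exp (Complex.I * k * u) := by
      rw [← Complex.exp_add]; congr 1; push_cast; ring
    rw [this]
    field_simp
    ring

lemma chord_neg_neg (k u : ℝ) : chord (-k) u = -chord k (-u) := by
  unfold chord
  by_cases h : k = 0
  · simp [h]
  · have hk : (k : ℂ) ≠ 0 := by exact_mod_cast h
    simp only [neg_eq_zero, h, if_false]
    push_cast
    rw [show Complex.I * -(k : ℂ) * u = Complex.I * k * -u by ring]
    field_simp

lemma exp_re (k u : ℝ) : (Complex.exp (Complex.I * k * u)).re = Real.cos (k * u) := by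
  rw [show Complex.I * (k : ℂ) * u = ((k * u : ℝ) : ℂ) * Complex.I by push_cast; ring]
  exact Complex.exp_ofReal_mul_I_re _

lemma exp_im (k u : ℝ) : (Complex.exp (Complex.I * k * u)).im = Real.sin (k * u) := by
  rw [show Complex.I * (k : ℂ) * u = ((k * u : ℝ) : ℂ) * Complex.I by push_cast; ring]
  exact Complex.exp_ofReal_mul_I_im _

lemma norm_exp (k u : ℝ) : ‖Complex.exp (Complex.I * k * u)‖ = 1 := by
  rw [show Complex.I * (k : ℂ) * u = ((k * u : ℝ) : ℂ) * Complex.I by push_cast; ring]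
  exact Complex.norm_exp_ofReal_mul_I _

lemma chord_eq_of_ne {k : ℝ} (hk : k ≠ 0) (u : ℝ) :
    chord k u = ⟨Real.sin (k * u) / k, (1 - Real.cos (k * u)) / k⟩ := by
  have hk' : (k : ℂ) ≠ 0 := by exact_mod_cast hk
  rw [chord, if_neg hk, div_eq_iff (mul_ne_zero Complex.I_ne_zero hk')]
  apply Complex.ext
  · simp [exp_re]
    rw [div_mul_cancel₀ _ hk]
    ring
  · simp [exp_im, hk]

lemma hasDerivAt_chord (k u : ℝ) :
    HasDerivAt (chord k) (Complex.exp (Complex.I * k * u)) u := by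
  by_cases h : k = 0
  · have : chord k = fun u : ℝ => (u : ℂ) := by funext x; simp [chord, h]
    rw [this]
    simpa [h] using (hasDerivAt_id u).ofReal_comp
  · have hk : (k : ℂ) ≠ 0 := by exact_mod_cast h
    have : chord k = fun u : ℝ =>
        (Complex.exp (Complex.I * k * u) - 1) / (Complex.I * k) := by
      funext x; simp [chord, h]
    rw [this]
    have h1 : HasDerivAt (fun u : ℝ => Complex.I * k * (u : ℂ)) (Complex.I * k * 1) u := by
      simpa using (((hasDerivAt_id u).ofReal_comp).const_mul (Complex.I * (k : ℂ)))
    have h2 := ((h1.cexp.sub_const 1).div_const (Complex.I * (k : ℂ)))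
    have : Complex.I * (k : ℂ) ≠ 0 := mul_ne_zero Complex.I_ne_zero hk
    rwa [mul_one, mul_div_assoc, div_self this, mul_one] at h2

lemma chord_ne_zero {k u : ℝ} (hu : u ≠ 0) (h : |k| * |u| < 2 * Real.pi) : chord k u ≠ 0 := by
  by_cases hk : k = 0
  · simpa [chord, hk] using hu
  · rw [chord_eq_of_ne hk]
    intro h0
    have hc : (1 - Real.cos (k * u)) / k = 0 := congrArg Complex.im h0
    have hc' : Real.cos (k * u) = 1 := by
      rcases div_eq_zero_iff.1 hc with h1 | h1
      · linarith
      · exact absurd h1 hk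
    rw [← abs_mul] at h
    have := (Real.cos_eq_one_iff_of_lt_of_lt (abs_lt.1 h).1 (abs_lt.1 h).2).1 hc'
    exact (mul_ne_zero hk hu) this

/-- Within half a turn an arc stays ahead of the normal line at its starting point. This keeps the
logarithm in the jump computation away from its branch cut. -/
lemma chord_re_pos {k u : ℝ} (hu : 0 < u) (h : |k| * u < Real.pi) : 0 < (chord k u).re := by
  by_cases hk : k = 0
  · simpa [chord, hk] using hu
  · rw [chord_eq_of_ne hk]
    rcases lt_or_gt_of_ne hk with h1 | h1
    · rw [abs_of_neg h1] at h
      exact div_pos_of_neg_of_neg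
        (Real.sin_neg_of_neg_of_neg_pi_lt (mul_neg_of_neg_of_pos h1 hu) (by linarith)) h1
    · rw [abs_of_pos h1] at h
      exact div_pos (Real.sin_pos_of_pos_of_lt_pi (mul_pos h1 hu) h) h1

lemma chord_re_neg {k u : ℝ} (hu : u < 0) (h : |k| * (-u) < Real.pi) : (chord k u).re < 0 := by
  have h1 : 0 < (chord (-k) (-u)).re := chord_re_pos (by linarith) (by rwa [abs_neg])
  rw [chord_neg_neg, neg_neg, Complex.neg_re] at h1
  linarith

lemma point_eq (a : Arc) (s : ℝ) : a.point s = a.start + a.dir * chord a.curv s := by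
  unfold point chord
  split_ifs <;> ring

@[simp] lemma point_zero (a : Arc) : a.point 0 = a.start := by simp [point_eq]

@[simp] lemma tangent_zero (a : Arc) : a.tangent 0 = a.dir := by simp [tangent]

lemma norm_tangent (a : Arc) (s : ℝ) : ‖a.tangent s‖ = 1 := by
  rw [tangent, norm_mul, a.norm_dir, norm_exp, one_mul]

lemma tangent_ne_zero (a : Arc) (s : ℝ) : a.tangent s ≠ 0 := by
  rw [← norm_ne_zero_iff, a.norm_tangent]; exact one_ne_zero

lemma tangent_add (a : Arc) (s u : ℝ) :
    a.tangent (s + u) = a.tangent s * Complex.exp (Complex.I * a.curv * u) := by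
  rw [tangent, tangent, mul_assoc a.dir, ← Complex.exp_add]
  congr 2; push_cast; ring

lemma point_add (a : Arc) (s u : ℝ) :
    a.point (s + u) = a.point s + a.tangent s * chord a.curv u := by
  rw [point_eq, point_eq, chord_add, tangent]; ring

lemma hasDerivAt_point (a : Arc) (s : ℝ) : HasDerivAt a.point (a.tangent s) s := by
  have : a.point = fun s => a.start + a.dir * chord a.curv s := funext a.point_eq
  rw [this]
  exact ((hasDerivAt_chord a.curv s).const_mul a.dir).const_add a.start

lemma continuous_point (a : Arc) : Continuous a.point :=
  continuous_iff_continuousAt.2 fun s => (a.hasDerivAt_point s).continuousAt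

lemma continuous_tangent (a : Arc) : Continuous a.tangent := by
  unfold tangent; fun_prop

lemma point_ne {a : Arc} {s t : ℝ} (hs : s ∈ Icc 0 a.len) (ht : t ∈ Icc 0 a.len) (h : s ≠ t) :
    a.point s ≠ a.point t := by
  have hst : s = t + (s - t) := by ring
  rw [hst, point_add]
  have : a.tangent t * chord a.curv (s - t) ≠ 0 := by
    refine mul_ne_zero (a.tangent_ne_zero t) (chord_ne_zero (sub_ne_zero.2 h) ?_)
    refine lt_of_le_of_lt (mul_le_mul_of_nonneg_left ?_ (abs_nonneg _)) a.not_closed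
    rw [abs_le]; constructor <;> linarith [hs.1, hs.2, ht.1, ht.2]
  simpa using this

lemma isCompact_carrier (a : Arc) : IsCompact a.carrier :=
  isCompact_Icc.image a.continuous_point

/-- A quadratic function that vanishes on the circle or line through the arc, and is positive to
the left of the arc. -/
noncomputable def side (a : Arc) (z : ℂ) : ℝ :=
  ((z - a.start) * (starRingEnd ℂ) a.dir).im - a.curv / 2 * Complex.normSq (z - a.start)

lemma dir_mul_conj (a : Arc) : a.dir * (starRingEnd ℂ) a.dir = 1 := by
  rw [Complex.mul_conj, Complex.normSq_eq_norm_sq, a.norm_dir]; norm_num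

lemma normSq_dir (a : Arc) : Complex.normSq a.dir = 1 := by
  rw [Complex.normSq_eq_norm_sq, a.norm_dir]; norm_num

lemma side_start_add (a : Arc) (x : ℂ) :
    a.side (a.start + a.dir * x) = x.im - a.curv / 2 * Complex.normSq x := by
  have : a.dir * x * (starRingEnd ℂ) a.dir = x := by
    rw [mul_right_comm, a.dir_mul_conj, one_mul]
  rw [side, add_sub_cancel_left, this, Complex.normSq_mul, normSq_dir, one_mul]

/-- For `k ≠ 0`, `side` is `-k/2` times the power of the point with respect to the circle, and
moving `ε` along the left normal changes the signed distance to the center from `1/k` to `1/k - ε`.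
-/
lemma side_normal (a : Arc) (s ε : ℝ) :
    a.side (a.point s + ε * a.leftNormal s) = ε - a.curv / 2 * ε ^ 2 := by
  have : a.point s + ε * a.leftNormal s = a.start + a.dir *
      (chord a.curv s + ε * Complex.I * Complex.exp (Complex.I * a.curv * s)) := by
    rw [point_eq, leftNormal, tangent]; ring
  rw [this, side_start_add]
  by_cases hk : a.curv = 0
  · simp [hk, chord]
  · rw [chord_eq_of_ne hk]
    have h1 := exp_re a.curv s
    have h2 := exp_im a.curv s
    have h3 := Real.sin_sq_add_cos_sq (a.curv * s)
    simp only [Complex.normSq_apply, Complex.add_re, Complex.add_im, Complex.mul_re,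
      Complex.mul_im, h1, h2, Complex.ofReal_re, Complex.ofReal_im, Complex.I_re, Complex.I_im]
    generalize Real.sin (a.curv * s) = S at *
    generalize Real.cos (a.curv * s) = C at *
    generalize a.curv = k at *
    field_simp
    have h4 : S ^ 2 = 1 - C ^ 2 := by linarith
    ring_nf
    rw [h4]
    ring

lemma side_point (a : Arc) (s : ℝ) : a.side (a.point s) = 0 := by
  simpa using a.side_normal s 0

lemma side_eq_zero_of_mem_carrier {a : Arc} {z : ℂ} (hz : z ∈ a.carrier) : a.side z = 0 := by
  obtain ⟨s, -, rfl⟩ := hz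
  exact a.side_point s

lemma continuous_side (a : Arc) : Continuous a.side := by
  unfold side
  exact (Complex.continuous_im.comp (by fun_prop)).sub
    (continuous_const.mul (Complex.continuous_normSq.comp (by fun_prop)))

lemma eventually_quadratic_pos (k : ℝ) : ∀ᶠ ε : ℝ in 𝓝[>] 0, 0 < ε - k / 2 * ε ^ 2 := by
  have h1 : ∀ᶠ ε : ℝ in 𝓝 0, 0 < 1 - k / 2 * ε :=
    (by fun_prop : Continuous fun ε : ℝ => 1 - k / 2 * ε).continuousAt.eventually
      (lt_mem_nhds (by norm_num))
  filter_upwards [h1.filter_mono nhdsWithin_le_nhds, self_mem_nhdsWithin] with ε h2 h3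
  have := mul_pos (mem_Ioi.1 h3) h2
  linarith

lemma eventually_side_left_pos (a : Arc) (s : ℝ) :
    ∀ᶠ ε : ℝ in 𝓝[>] 0, 0 < a.side (a.point s + ε * a.leftNormal s) := by
  filter_upwards [eventually_quadratic_pos a.curv] with ε h
  rwa [side_normal]

lemma eventually_side_right_neg (a : Arc) (s : ℝ) :
    ∀ᶠ ε : ℝ in 𝓝[>] 0, a.side (a.point s - ε * a.leftNormal s) < 0 := by
  filter_upwards [eventually_quadratic_pos (-a.curv)] with ε h
  have := a.side_normal s (-ε)
  push_cast at this
  rw [neg_mul, ← sub_eq_add_neg] at this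
  rw [this]
  linarith

lemma tendsto_normal (x n : ℂ) : Tendsto (fun ε : ℝ => x + ε * n) (𝓝[>] 0) (𝓝 x) := by
  have : Continuous fun ε : ℝ => x + ε * n := by fun_prop
  simpa using (this.tendsto 0).mono_left nhdsWithin_le_nhds

end Arc

/-! ### Bubbles, and interior points of curves -/

variable {ι : Type*}

lemma isClosed_figure [Finite ι] (A : ι → Arc) : IsClosed (figure A) :=
  isClosed_iUnion_of_finite fun i => (A i).isCompact_carrier.isClosed

lemma Bubble.eq_connectedComponentIn {A : ι → Arc} (B : Bubble A) {z : ℂ} (hz : z ∈ B.1) :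
    B.1 = connectedComponentIn (figure A)ᶜ z := by
  obtain ⟨w, hw, h⟩ := B.2
  rw [h] at hz ⊢
  exact connectedComponentIn_eq hz

lemma Bubble.nonempty {A : ι → Arc} (B : Bubble A) : B.1.Nonempty := by
  obtain ⟨w, hw, h⟩ := B.2
  exact ⟨w, h ▸ mem_connectedComponentIn hw⟩

/-- A curve of a collection has no interior point on any of the other curves. -/
lemma PlateauLaws.point_notMem_carrier [Fintype ι] {A : ι → Arc} (hA : PlateauLaws A) {i j : ι}
    (hij : j ≠ i) {s : ℝ} (hs : s ∈ Ioo 0 (A i).len) : (A i).point s ∉ (A j).carrier := by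
  intro h
  obtain ⟨b, hb⟩ := (hA.noncrossing i j hij.symm ⟨⟨s, Ioo_subset_Icc_self hs, rfl⟩, h⟩).1
  have hl := (A i).len_pos.le
  cases b
  · exact Arc.point_ne (left_mem_Icc.2 hl) (Ioo_subset_Icc_self hs) hs.1.ne hb
  · exact Arc.point_ne (right_mem_Icc.2 hl) (Ioo_subset_Icc_self hs) hs.2.ne' hb

/-! ### Cauchy integrals along arcs and their jump -/

namespace Arc

/-- The Cauchy integral over the part of a curve between two values of arc length. -/
noncomputable def cauchy (a : Arc) (α β : ℝ) (z : ℂ) : ℂ :=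
  ∫ t in α..β, a.tangent t / (a.point t - z)

lemma intervalIntegrable_cauchy {a : Arc} {α β : ℝ} {z : ℂ} (hz : z ∉ a.point '' uIcc α β) :
    IntervalIntegrable (fun t => a.tangent t / (a.point t - z)) MeasureTheory.volume α β := by
  apply ContinuousOn.intervalIntegrable
  refine a.continuous_tangent.continuousOn.div
    (a.continuous_point.sub continuous_const).continuousOn fun t ht h => hz ⟨t, ht, ?_⟩
  exact sub_eq_zero.1 h

/-- Differentiation under the integral gives the integrand `tangent / (point - z)^2`, which is the
exact derivative of `-1 / (point - z)` along the curve, so only the ends contribute. -/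
lemma hasDerivAt_cauchy {a : Arc} {α β : ℝ} {z : ℂ} (hz : z ∉ a.point '' uIcc α β) :
    HasDerivAt (a.cauchy α β) (1 / (a.point α - z) - 1 / (a.point β - z)) z := by
  have hK : IsClosed (a.point '' uIcc α β) := (isCompact_uIcc.image a.continuous_point).isClosed
  obtain ⟨δ, hδ, hball⟩ := Metric.isOpen_iff.1 hK.isOpen_compl z hz
  -- Halving the radius keeps a uniform distance `δ / 2` from the curve, hence a constant dominating
  -- function.
  have hfar : ∀ x ∈ Metric.ball z (δ / 2), ∀ t ∈ uIcc α β, δ / 2 ≤ ‖a.point t - x‖ := by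
    intro x hx t ht
    by_contra! h
    have : a.point t ∈ Metric.ball z δ := by
      rw [Metric.mem_ball] at hx ⊢
      rw [← dist_eq_norm] at h
      linarith [dist_triangle (a.point t) x z]
    exact hball this ⟨t, ht, rfl⟩
  have hne : ∀ x ∈ Metric.ball z (δ / 2), ∀ t ∈ uIcc α β, a.point t - x ≠ 0 := by
    intro x hx t ht h
    have := hfar x hx t ht
    rw [h, norm_zero] at this
    linarith
  have hzb : z ∈ Metric.ball z (δ / 2) := Metric.mem_ball_self (by linarith)
  have hint : IntervalIntegrable (fun t => a.tangent t / (a.point t - z) ^ 2)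
      MeasureTheory.volume α β := by
    apply ContinuousOn.intervalIntegrable
    exact a.continuous_tangent.continuousOn.div
      ((a.continuous_point.sub continuous_const).pow 2).continuousOn
      fun t ht => pow_ne_zero 2 (hne z hzb t ht)
  have hFTC : ∫ t in α..β, a.tangent t / (a.point t - z) ^ 2
      = 1 / (a.point α - z) - 1 / (a.point β - z) := by
    rw [intervalIntegral.integral_eq_sub_of_hasDerivAt
      (f := fun t => -(a.point t - z)⁻¹) (fun t ht => ?_) hint]
    · ring
    · have := (((a.hasDerivAt_point t).sub_const z).inv (hne z hzb t ht)).neg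
      refine this.congr_deriv ?_
      ring
  rw [← hFTC]
  refine (intervalIntegral.hasDerivAt_integral_of_dominated_loc_of_deriv_le
    (F := fun x t => a.tangent t / (a.point t - x))
    (F' := fun x t => a.tangent t / (a.point t - x) ^ 2) (bound := fun _ => 1 / (δ / 2) ^ 2)
    (Metric.ball_mem_nhds z (half_pos hδ)) ?_ (intervalIntegrable_cauchy hz) ?_ ?_
    intervalIntegrable_const ?_).2
  · filter_upwards [hK.isOpen_compl.mem_nhds hz] with x hx
    exact (intervalIntegrable_iff.1 (intervalIntegrable_cauchy hx)).aestronglyMeasurable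
  · exact (intervalIntegrable_iff.1 hint).aestronglyMeasurable
  · refine Eventually.of_forall fun t ht x hx => ?_
    rw [norm_div, a.norm_tangent, norm_pow]
    exact one_div_le_one_div_of_le (by positivity)
      (pow_le_pow_left₀ (by positivity) (hfar x hx t (uIoc_subset_uIcc ht)) 2)
  · refine Eventually.of_forall fun t ht x hx => ?_
    have h1 := ((hasDerivAt_id x).const_sub (a.point t)).inv (hne x hx t (uIoc_subset_uIcc ht))
    have h2 := h1.const_mul (a.tangent t)
    refine h2.congr_deriv ?_
    simp [div_eq_mul_inv]

/-- The jump of a Cauchy integral at a point that is not on the curve is zero. -/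
lemma tendsto_cauchy_sub_zero {a : Arc} {α β : ℝ} {x : ℂ} (hx : x ∉ a.point '' uIcc α β)
    (n : ℂ) : Tendsto (fun ε : ℝ => a.cauchy α β (x + ε * n) - a.cauchy α β (x - ε * n))
      (𝓝[>] 0) (𝓝 0) := by
  have hc := (hasDerivAt_cauchy hx).continuousAt
  have h1 := hc.tendsto.comp (tendsto_normal x n)
  have h2 := hc.tendsto.comp (tendsto_normal x (-n))
  simpa [Function.comp_def, sub_eq_add_neg] using h1.sub h2

/-- The logarithm of this quotient is a primitive of the difference of two Cauchy kernels. -/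
noncomputable def quot (ε : ℝ) (w : ℂ) : ℂ :=
  -(w - ε * Complex.I) / (w + ε * Complex.I)

lemma add_ne_zero_of_re {w : ℂ} (hw : w.re ≠ 0) (ε : ℝ) : w + ε * Complex.I ≠ 0 := by
  intro h
  apply hw
  simpa using congrArg Complex.re h

lemma quot_im (ε : ℝ) (w : ℂ) :
    (quot ε w).im = 2 * ε * w.re / Complex.normSq (w + ε * Complex.I) := by
  rw [quot, Complex.div_im]
  simp
  ring

/-- The imaginary part of `quot ε w` has the sign of `w.re`, and `quot ε 0 = 1`. The minus sign in
`quot` is what puts the crossing `w = 0` at `1` rather than on the cut. -/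
lemma quot_mem_slitPlane {ε : ℝ} (hε : 0 < ε) {w : ℂ} (hw : w.re ≠ 0 ∨ w = 0) :
    quot ε w ∈ Complex.slitPlane := by
  rcases hw with hw | rfl
  · refine Or.inr ?_
    rw [quot_im]
    have := Complex.normSq_pos.2 (add_ne_zero_of_re hw ε)
    positivity
  · have : (ε : ℂ) * Complex.I ≠ 0 :=
      mul_ne_zero (by exact_mod_cast hε.ne') Complex.I_ne_zero
    have h1 : quot ε 0 = 1 := by
      rw [quot]; simp only [zero_sub, neg_neg, zero_add]; exact div_self this
    rw [h1]
    exact Complex.one_mem_slitPlane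

lemma tendsto_quot {w : ℂ} (hw : w.re ≠ 0) :
    Tendsto (fun ε : ℝ => quot ε w) (𝓝[>] 0) (𝓝 (-1)) := by
  have hw0 : w ≠ 0 := fun h => hw (by simp [h])
  have : ContinuousAt (fun ε : ℝ => quot ε w) 0 := by
    unfold quot
    refine ContinuousAt.div (by fun_prop) (by fun_prop) (by simpa using hw0)
  have h := this.tendsto.mono_left (nhdsWithin_le_nhds (s := Ioi 0))
  have h0 : quot 0 w = -1 := by
    simp [quot, neg_div, div_self hw0]
  rwa [h0] at h

/-- Ahead of the base point the quotient approaches `-1` from the upper half-plane; behind it, from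
the lower one. The two boundary values `±πi` of the logarithm produce the jump `2πi`. -/
lemma tendsto_log_quot_pos {w : ℂ} (hw : 0 < w.re) :
    Tendsto (fun ε : ℝ => Complex.log (quot ε w)) (𝓝[>] 0) (𝓝 (Real.pi * Complex.I)) := by
  have h := (Complex.continuousWithinAt_log_of_re_neg_of_im_zero
    (z := -1) (by simp) (by simp)).tendsto
  rw [Complex.log_neg_one] at h
  refine h.comp (tendsto_nhdsWithin_iff.2 ⟨tendsto_quot hw.ne', ?_⟩)
  filter_upwards [self_mem_nhdsWithin] with ε hε
  rw [quot_im]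
  have := Complex.normSq_nonneg (w + ε * Complex.I)
  have h2 : (0 : ℝ) < ε := hε
  positivity

lemma tendsto_log_quot_neg {w : ℂ} (hw : w.re < 0) :
    Tendsto (fun ε : ℝ => Complex.log (quot ε w)) (𝓝[>] 0) (𝓝 (-(Real.pi * Complex.I))) := by
  have h := Complex.tendsto_log_nhdsWithin_im_neg_of_re_neg_of_im_zero
    (z := -1) (by simp) (by simp)
  simp only [norm_neg, norm_one, Real.log_one, Complex.ofReal_zero, zero_sub] at h
  refine h.comp (tendsto_nhdsWithin_iff.2 ⟨tendsto_quot hw.ne, ?_⟩)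
  filter_upwards [self_mem_nhdsWithin] with ε hε
  rw [quot_im]
  have := Complex.normSq_pos.2 (add_ne_zero_of_re hw.ne ε)
  have h2 : (0 : ℝ) < ε := hε
  exact div_neg_of_neg_of_pos (mul_neg_of_pos_of_neg (by positivity) hw) this

/-- In the frame at `point s` the curve is `w = chord (t - s)` and the two evaluation points are
`±εi`, so the difference of kernels is `w'/(w - εi) - w'/(w + εi)`, a logarithmic derivative. -/
lemma hasDerivAt_log_quot {a : Arc} {s ε : ℝ} (hε : 0 < ε) {t : ℝ}
    (ht : |a.curv| * |t - s| < Real.pi) :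
    HasDerivAt (fun t => Complex.log (quot ε (chord a.curv (t - s))))
      (a.tangent t / (a.point t - (a.point s + ε * a.leftNormal s))
        - a.tangent t / (a.point t - (a.point s - ε * a.leftNormal s))) t := by
  have hεI : (ε : ℂ) * Complex.I ≠ 0 :=
    mul_ne_zero (by exact_mod_cast hε.ne') Complex.I_ne_zero
  set w := chord a.curv (t - s) with hw
  have hw' : w.re ≠ 0 ∨ w = 0 := by
    rcases lt_trichotomy (t - s) 0 with h | h | h
    · rw [abs_of_neg h] at ht; exact Or.inl (chord_re_neg h ht).ne
    · right; rw [hw, h, chord_zero]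
    · rw [abs_of_pos h] at ht; exact Or.inl (chord_re_pos h ht).ne'
  have hp : w + ε * Complex.I ≠ 0 := by
    rcases hw' with h | h
    · exact add_ne_zero_of_re h ε
    · rwa [h, zero_add]
  have hm : w - ε * Complex.I ≠ 0 := by
    rcases hw' with h | h
    · simpa [sub_eq_add_neg] using add_ne_zero_of_re h (-ε)
    · rw [h, zero_sub]; exact neg_ne_zero.2 hεI
  have hd : HasDerivAt (fun t => chord a.curv (t - s))
      (Complex.exp (Complex.I * a.curv * (t - s : ℝ))) t := by
    have := (hasDerivAt_chord a.curv (t - s)).scomp t ((hasDerivAt_id t).sub_const s)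
    simpa [Function.comp_def] using this
  have hq := ((hd.sub_const (ε * Complex.I)).neg.div (hd.add_const (ε * Complex.I)) hp)
  have hl := hq.clog_real (quot_mem_slitPlane hε hw')
  refine hl.congr_deriv (Eq.symm ?_)
  have hpt : a.point t = a.point s + a.tangent s * w := by
    rw [hw, ← point_add]; congr 1; ring
  have htt : a.tangent t
      = a.tangent s * Complex.exp (Complex.I * a.curv * (t - s : ℝ)) := by
    rw [← tangent_add]; congr 1; ring
  have hT := a.tangent_ne_zero s
  have e1 : a.point t - (a.point s + ε * a.leftNormal s)
      = a.tangent s * (w - ε * Complex.I) := by rw [hpt, leftNormal]; ring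
  have e2 : a.point t - (a.point s - ε * a.leftNormal s)
      = a.tangent s * (w + ε * Complex.I) := by rw [hpt, leftNormal]; ring
  rw [e1, e2, htt, mul_div_mul_left _ _ hT, mul_div_mul_left _ _ hT]
  simp only [Pi.div_apply, Pi.neg_apply, ← hw]
  generalize Complex.exp _ = E
  rw [div_sub_div _ _ hm hp, div_div_eq_mul_div]
  field_simp
  ring

/-- The Plemelj jump relation near an interior point of a curve. -/
lemma tendsto_cauchy_sub_near (a : Arc) (s : ℝ) {δ : ℝ} (hδ : 0 < δ)
    (hk : |a.curv| * δ < Real.pi) :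
    Tendsto (fun ε : ℝ => a.cauchy (s - δ) (s + δ) (a.point s + ε * a.leftNormal s)
      - a.cauchy (s - δ) (s + δ) (a.point s - ε * a.leftNormal s))
      (𝓝[>] 0) (𝓝 (2 * Real.pi * Complex.I)) := by
  have h1 := tendsto_log_quot_pos (chord_re_pos hδ hk)
  have h2 := tendsto_log_quot_neg (chord_re_neg (k := a.curv) (u := -δ) (by linarith)
    (by simpa using hk))
  have h3 := h1.sub h2
  rw [show (Real.pi * Complex.I - -(Real.pi * Complex.I) : ℂ) = 2 * Real.pi * Complex.I by ring]
    at h3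
  -- For fixed `ε` the difference of the two integrals is the increment of `log (quot ε w)` between
  -- the ends of the short arc.
  refine h3.congr' ?_
  filter_upwards [self_mem_nhdsWithin, a.eventually_side_left_pos s,
    a.eventually_side_right_neg s] with ε hε hL hR
  have hε' : (0 : ℝ) < ε := hε
  have i1 : IntervalIntegrable
      (fun t => a.tangent t / (a.point t - (a.point s + ε * a.leftNormal s)))
      MeasureTheory.volume (s - δ) (s + δ) := intervalIntegrable_cauchy (by
    rintro ⟨t, -, h⟩
    rw [← h, side_point] at hL
    exact lt_irrefl _ hL)
  have i2 : IntervalIntegrable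
      (fun t => a.tangent t / (a.point t - (a.point s - ε * a.leftNormal s)))
      MeasureTheory.volume (s - δ) (s + δ) := intervalIntegrable_cauchy (by
    rintro ⟨t, -, h⟩
    rw [← h, side_point] at hR
    exact lt_irrefl _ hR)
  rw [cauchy, cauchy, ← intervalIntegral.integral_sub i1 i2,
    intervalIntegral.integral_eq_sub_of_hasDerivAt
      (fun t ht => hasDerivAt_log_quot (s := s) hε' ?_) (i1.sub i2)]
  · simp
  · rw [uIcc_of_le (by linarith)] at ht
    refine lt_of_le_of_lt (mul_le_mul_of_nonneg_left ?_ (abs_nonneg _)) hk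
    rw [abs_le]; constructor <;> linarith [ht.1, ht.2]

/-- The Plemelj jump relation at an interior point of a curve. -/
lemma tendsto_cauchy_sub (a : Arc) {s : ℝ} (hs : s ∈ Ioo 0 a.len) :
    Tendsto (fun ε : ℝ => a.cauchy 0 a.len (a.point s + ε * a.leftNormal s)
      - a.cauchy 0 a.len (a.point s - ε * a.leftNormal s))
      (𝓝[>] 0) (𝓝 (2 * Real.pi * Complex.I)) := by
  obtain ⟨δ, hδ, h1, h2, hk⟩ : ∃ δ > 0, δ < s ∧ δ < a.len - s ∧ |a.curv| * δ < Real.pi := by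
    have e1 : ∀ᶠ δ : ℝ in 𝓝[>] 0, δ < s :=
      nhdsWithin_le_nhds (gt_mem_nhds hs.1)
    have e2 : ∀ᶠ δ : ℝ in 𝓝[>] 0, δ < a.len - s :=
      nhdsWithin_le_nhds (gt_mem_nhds (by linarith [hs.2]))
    have e3 : ∀ᶠ δ : ℝ in 𝓝[>] 0, |a.curv| * δ < Real.pi :=
      nhdsWithin_le_nhds ((by fun_prop : Continuous fun δ : ℝ => |a.curv| * δ).continuousAt
        |>.eventually (gt_mem_nhds (by simpa using Real.pi_pos)))
    obtain ⟨δ, ⟨⟨h1, h2⟩, h3⟩, h4⟩ := ((e1.and e2).and e3 |>.and self_mem_nhdsWithin).exists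
    exact ⟨δ, h4, h1, h2, h3⟩
  have hs' : s ∈ Icc 0 a.len := Ioo_subset_Icc_self hs
  have n1 : a.point s ∉ a.point '' uIcc 0 (s - δ) := by
    rintro ⟨t, ht, h⟩
    rw [uIcc_of_le (by linarith)] at ht
    exact point_ne ⟨ht.1, by linarith [ht.2, hs.2]⟩ hs' (by linarith [ht.2] : t < s).ne h
  have n2 : a.point s ∉ a.point '' uIcc (s + δ) a.len := by
    rintro ⟨t, ht, h⟩
    rw [uIcc_of_le (by linarith)] at ht
    exact point_ne ⟨by linarith [ht.1, hs.1], ht.2⟩ hs' (by linarith [ht.1] : s < t).ne' h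
  -- The two outer pieces of the arc miss `point s`, so only the middle piece has a jump.
  have h := ((tendsto_cauchy_sub_zero n1 (a.leftNormal s)).add
    (a.tendsto_cauchy_sub_near s hδ hk)).add (tendsto_cauchy_sub_zero n2 (a.leftNormal s))
  rw [zero_add, add_zero] at h
  -- A point with nonzero `side` is off the whole circle or line, so the kernel is integrable over
  -- every parameter interval.
  have split : ∀ z, a.side z ≠ 0 → a.cauchy 0 a.len z
      = a.cauchy 0 (s - δ) z + a.cauchy (s - δ) (s + δ) z + a.cauchy (s + δ) a.len z := by
    intro z hz
    have hi : ∀ α β, IntervalIntegrable (fun t => a.tangent t / (a.point t - z))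
        MeasureTheory.volume α β := fun α β => intervalIntegrable_cauchy (by
      rintro ⟨t, -, rfl⟩
      exact hz (a.side_point t))
    rw [cauchy, cauchy, cauchy, cauchy,
      intervalIntegral.integral_add_adjacent_intervals (hi _ _) (hi _ _),
      intervalIntegral.integral_add_adjacent_intervals (hi _ _) (hi _ _)]
  refine h.congr' ?_
  filter_upwards [a.eventually_side_left_pos s, a.eventually_side_right_neg s] with ε hL hR
  rw [split _ hL.ne', split _ hR.ne]
  ring

end Arc

/-! ### The potential: balanced curvatures yield pressures -/

variable {ι : Type*}

/-- The other curves are closed and miss an interior point of curve `i`; curve `i` itself lies in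
the zero set of its `side`. -/
lemma eventually_notMem_figure [Fintype ι] {A : ι → Arc} (hA : PlateauLaws A) {i : ι} {s : ℝ}
    (hs : s ∈ Ioo 0 (A i).len) {n : ℂ}
    (hn : ∀ᶠ ε : ℝ in 𝓝[>] 0, (A i).side ((A i).point s + ε * n) ≠ 0) :
    ∀ᶠ ε : ℝ in 𝓝[>] 0, (A i).point s + ε * n ∉ figure A := by
  have : ∀ j, ∀ᶠ ε : ℝ in 𝓝[>] 0, (A i).point s + ε * n ∉ (A j).carrier := by
    intro j
    by_cases hij : j = i
    · subst hij
      filter_upwards [hn] with ε h h'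
      exact h (Arc.side_eq_zero_of_mem_carrier h')
    · exact (Arc.tendsto_normal _ n).eventually ((A j).isCompact_carrier.isClosed.isOpen_compl.mem_nhds
        (hA.point_notMem_carrier hij hs))
  filter_upwards [eventually_all.2 this] with ε h
  simpa [figure] using h

/-- A short open segment issuing from `x` is connected and misses the figure, so it lies in a single
component. -/
lemma exists_bubble {A : ι → Arc} {x n : ℂ} (h : ∀ᶠ ε : ℝ in 𝓝[>] 0, x + ε * n ∉ figure A) :
    ∃ B : Bubble A, ∀ᶠ ε : ℝ in 𝓝[>] 0, x + ε * n ∈ B.1 := by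
  obtain ⟨δ, hδ, h⟩ := mem_nhdsGT_iff_exists_Ioo_subset.1 h
  have hδ' : (0 : ℝ) < δ := hδ
  have hmem : δ / 2 ∈ Ioo 0 δ := ⟨by linarith, by linarith⟩
  refine ⟨⟨_, x + (δ / 2 : ℝ) * n, h hmem, rfl⟩, ?_⟩
  have hpre : IsPreconnected ((fun ε : ℝ => x + ε * n) '' Ioo 0 δ) :=
    isPreconnected_Ioo.image _ (by fun_prop)
  filter_upwards [Ioo_mem_nhdsGT hδ'] with ε hε
  refine hpre.subset_connectedComponentIn ⟨_, hmem, rfl⟩ ?_ ⟨ε, hε, rfl⟩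
  rintro _ ⟨t, ht, rfl⟩
  exact h ht

/-- The Cauchy integral over all curves, weighted by their curvatures. -/
noncomputable def potential [Fintype ι] (A : ι → Arc) (z : ℂ) : ℂ :=
  ∑ i, ((A i).curv : ℂ) * (A i).cauchy 0 (A i).len z

/-- The curvature condition at all the vertices. -/
def Balanced [Fintype ι] (A : ι → Arc) : Prop :=
  ∀ (i : ι) (b : Bool), ∑ e ∈ endsAt A ((A i).endpoint b), (A e.1).signedCurvature e.2 = 0

/-- Each curve contributes minus its signed curvature times `g` at each of its ends. Grouping the
ends by vertex makes `g` a common factor of a vanishing sum. -/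
lemma Balanced.sum_eq_zero [Fintype ι] {A : ι → Arc} (h : Balanced A) (g : ℂ → ℂ) :
    ∑ i, ((A i).curv : ℂ) * (g ((A i).point 0) - g ((A i).point (A i).len)) = 0 := by
  classical
  have h1 : ∑ i, ((A i).curv : ℂ) * (g ((A i).point 0) - g ((A i).point (A i).len))
      = -∑ e : ι × Bool, ((A e.1).signedCurvature e.2 : ℂ) * g ((A e.1).endpoint e.2) := by
    rw [Fintype.sum_prod_type, ← Finset.sum_neg_distrib]
    refine Finset.sum_congr rfl fun i _ => ?_
    simp [Arc.signedCurvature, Arc.endpoint]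
    ring
  rw [h1, neg_eq_zero, ← Finset.sum_fiberwise_of_maps_to
    (t := Finset.univ.image fun e : ι × Bool => (A e.1).endpoint e.2)
    (g := fun e : ι × Bool => (A e.1).endpoint e.2)
    (fun e _ => Finset.mem_image_of_mem _ (Finset.mem_univ e))]
  refine Finset.sum_eq_zero fun v hv => ?_
  obtain ⟨⟨i, b⟩, -, rfl⟩ := Finset.mem_image.1 hv
  have h2 := h i b
  rw [endsAt] at h2
  rw [Finset.sum_congr rfl (g := fun e : ι × Bool =>
      ((A e.1).signedCurvature e.2 : ℂ) * g ((A i).endpoint b)) fun e he => by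
    rw [(Finset.mem_filter.1 he).2], ← Finset.sum_mul]
  have h3 := congrArg (fun x : ℝ => (x : ℂ)) h2
  simp only [Complex.ofReal_sum, Complex.ofReal_zero] at h3
  convert zero_mul _

/-- The derivative is the endpoint sum of `Balanced.sum_eq_zero` for `g w = 1 / (w - z)`. -/
lemma Balanced.hasDerivAt_potential [Fintype ι] {A : ι → Arc} (h : Balanced A) {z : ℂ}
    (hz : z ∉ figure A) : HasDerivAt (potential A) 0 z := by
  rw [← h.sum_eq_zero fun w => 1 / (w - z)]
  refine HasDerivAt.fun_sum fun i _ => (Arc.hasDerivAt_cauchy ?_).const_mul _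
  rw [uIcc_of_le (A i).len_pos.le]
  exact fun h' => hz (mem_iUnion.2 ⟨i, h'⟩)

lemma Balanced.potential_eq [Fintype ι] {A : ι → Arc} (h : Balanced A) (B : Bubble A) {z w : ℂ}
    (hz : z ∈ B.1) (hw : w ∈ B.1) : potential A z = potential A w := by
  have hB := B.eq_connectedComponentIn hz
  have hsub : B.1 ⊆ (figure A)ᶜ := hB ▸ connectedComponentIn_subset _ _
  refine IsOpen.is_const_of_deriv_eq_zero (s := B.1) ?_ ?_ ?_ ?_ hz hw
  · rw [hB]; exact (isClosed_figure A).isOpen_compl.connectedComponentIn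
  · rw [hB]; exact isPreconnected_connectedComponentIn
  · exact fun x hx =>
      (h.hasDerivAt_potential (hsub hx)).differentiableAt.differentiableWithinAt
  · exact fun x hx => (h.hasDerivAt_potential (hsub hx)).deriv

/-- Only the Cauchy integral over curve `i` itself jumps at an interior point of that curve. -/
lemma tendsto_potential_sub [Fintype ι] {A : ι → Arc} (hA : PlateauLaws A) {i : ι} {s : ℝ}
    (hs : s ∈ Ioo 0 (A i).len) :
    Tendsto (fun ε : ℝ => potential A ((A i).point s + ε * (A i).leftNormal s)
      - potential A ((A i).point s - ε * (A i).leftNormal s))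
      (𝓝[>] 0) (𝓝 ((A i).curv * (2 * Real.pi * Complex.I))) := by
  classical
  have h : ∀ j ∈ Finset.univ, Tendsto (fun ε : ℝ => ((A j).curv : ℂ) *
      ((A j).cauchy 0 (A j).len ((A i).point s + ε * (A i).leftNormal s)
        - (A j).cauchy 0 (A j).len ((A i).point s - ε * (A i).leftNormal s))) (𝓝[>] 0)
      (𝓝 (if j = i then (A i).curv * (2 * Real.pi * Complex.I) else 0)) := by
    intro j _
    split_ifs with hj
    · subst hj
      exact ((A j).tendsto_cauchy_sub hs).const_mul _
    · have hn : (A i).point s ∉ (A j).point '' uIcc 0 (A j).len := by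
        rw [uIcc_of_le (A j).len_pos.le]
        exact hA.point_notMem_carrier hj hs
      simpa using (Arc.tendsto_cauchy_sub_zero hn ((A i).leftNormal s)).const_mul ((A j).curv : ℂ)
  have h2 := tendsto_finsetSum _ h
  rw [Finset.sum_ite_eq' Finset.univ i, if_pos (Finset.mem_univ i)] at h2
  refine h2.congr fun ε => ?_
  rw [potential, potential, ← Finset.sum_sub_distrib]
  exact Finset.sum_congr rfl fun j _ => mul_sub _ _ _

theorem Balanced.exists_youngLaplace [Fintype ι] {A : ι → Arc} (h : Balanced A)
    (hA : PlateauLaws A) (σ : ℝ) : ∃ p : Bubble A → ℝ, YoungLaplace σ A p := by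
  refine ⟨fun B => σ * (potential A B.nonempty.some / (2 * Real.pi * Complex.I)).re, ?_⟩
  intro i s hs
  have hL : ∀ᶠ ε : ℝ in 𝓝[>] 0, (A i).point s + ε * (A i).leftNormal s ∉ figure A :=
    eventually_notMem_figure hA hs
      (((A i).eventually_side_left_pos s).mono fun _ h => h.ne')
  have hR : ∀ᶠ ε : ℝ in 𝓝[>] 0, (A i).point s + ε * (-(A i).leftNormal s) ∉ figure A :=
    eventually_notMem_figure hA hs
      (((A i).eventually_side_right_neg s).mono fun _ h => by
        rw [mul_neg, ← sub_eq_add_neg]; exact h.ne)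
  obtain ⟨L, hL⟩ := exists_bubble hL
  obtain ⟨R, hR⟩ := exists_bubble hR
  simp only [mul_neg, ← sub_eq_add_neg] at hR
  refine ⟨L, R, hL, hR, ?_⟩
  have hlim : potential A L.nonempty.some - potential A R.nonempty.some
      = (A i).curv * (2 * Real.pi * Complex.I) := by
    -- The potential is constant on `L` and on `R`, so the difference across the curve is eventually
    -- constant and equals its limit.
    refine tendsto_nhds_unique (tendsto_const_nhds.congr' ?_) (tendsto_potential_sub hA hs)
    filter_upwards [hL, hR] with ε h1 h2
    rw [h.potential_eq L L.nonempty.some_mem h1, h.potential_eq R R.nonempty.some_mem h2]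
  rw [← mul_sub, ← Complex.sub_re, ← sub_div, hlim, mul_div_assoc,
    div_self Complex.two_pi_I_ne_zero, mul_one, Complex.ofReal_re]

/-! ### Curves oriented away from a vertex -/

namespace Arc

/-- The same curve, traversed backwards. -/
noncomputable def reverse (a : Arc) : Arc where
  start := a.point a.len
  dir := -a.tangent a.len
  curv := -a.curv
  len := a.len
  norm_dir := by rw [norm_neg, a.norm_tangent]
  len_pos := a.len_pos
  not_closed := by rw [abs_neg]; exact a.not_closed

lemma reverse_point (a : Arc) (s : ℝ) : a.reverse.point s = a.point (a.len - s) := by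
  rw [sub_eq_add_neg, point_add, point_eq]
  simp only [reverse, chord_neg_neg]
  ring

lemma reverse_tangent (a : Arc) (s : ℝ) : a.reverse.tangent s = -a.tangent (a.len - s) := by
  rw [sub_eq_add_neg, tangent_add, tangent]
  simp [reverse]

lemma reverse_carrier (a : Arc) : a.reverse.carrier = a.carrier := by
  ext z
  constructor
  · rintro ⟨s, hs, rfl⟩
    refine ⟨a.len - s, ⟨?_, ?_⟩, (a.reverse_point s).symm⟩
    · have : s ≤ a.len := hs.2
      linarith
    · linarith [hs.1]
  · rintro ⟨s, hs, rfl⟩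
    refine ⟨a.len - s, ⟨by linarith [hs.2], ?_⟩, ?_⟩
    · change a.len - s ≤ a.len
      linarith [hs.1]
    · rw [reverse_point]; congr 1; ring

/-- The curve, traversed so that it starts at the given end. -/
noncomputable def outward (a : Arc) : Bool → Arc
  | false => a
  | true => a.reverse

lemma outward_start (a : Arc) (b : Bool) : (a.outward b).start = a.endpoint b := by
  cases b
  · simp [outward, endpoint]
  · rfl

lemma outward_dir (a : Arc) (b : Bool) : (a.outward b).dir = a.outgoing b := by
  cases b
  · simp [outward, outgoing]
  · rfl

lemma outward_carrier (a : Arc) (b : Bool) : (a.outward b).carrier = a.carrier := by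
  cases b
  · rfl
  · exact a.reverse_carrier

/-! ### The sector between two curves at angle 2π/3 -/

/-- The complex number `exp (2 π i / 3)`. -/
noncomputable def third : ℂ := ⟨-1 / 2, √3 / 2⟩

lemma third_mul_conj : third * (starRingEnd ℂ) third = 1 := by
  have h : √3 * √3 = 3 := Real.mul_self_sqrt (by norm_num)
  apply Complex.ext <;> simp [third] <;> linarith

lemma normSq_third : Complex.normSq third = 1 := by
  have h : √3 * √3 = 3 := Real.mul_self_sqrt (by norm_num)
  simp [Complex.normSq_apply, third]
  linarith

lemma third_mul_third : third * third = (starRingEnd ℂ) third := by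
  have h : √3 * √3 = 3 := Real.mul_self_sqrt (by norm_num)
  apply Complex.ext <;> simp [third] <;> linarith

/-- The complex number `exp (π i / 3)`. -/
noncomputable def bisector : ℂ := ⟨1 / 2, √3 / 2⟩

lemma conj_bisector_mul_third : (starRingEnd ℂ) bisector * third = bisector := by
  have h : √3 * √3 = 3 := Real.mul_self_sqrt (by norm_num)
  apply Complex.ext <;> simp [third, bisector] <;> linarith

lemma norm_bisector : ‖bisector‖ = 1 := by
  have h : √3 * √3 = 3 := Real.mul_self_sqrt (by norm_num)
  rw [← sq_eq_sq₀ (norm_nonneg _) zero_le_one, ← Complex.normSq_eq_norm_sq]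
  simp [Complex.normSq_apply, bisector]
  linarith

lemma norm_third : ‖third‖ = 1 := by
  rw [← sq_eq_sq₀ (norm_nonneg _) zero_le_one, ← Complex.normSq_eq_norm_sq, normSq_third, one_pow]

/-- The function `side` in coordinates adapted to the beginning of the curve. -/
noncomputable def height (k : ℝ) (x : ℂ) : ℝ := x.im - k / 2 * Complex.normSq x

lemma side_eq_height (a : Arc) (x : ℂ) : a.side (a.start + a.dir * x) = height a.curv x :=
  a.side_start_add x

/-- The map `x ↦ conj x * third` is the reflection in the bisector of the sector. It exchanges the
two starting directions and reverses the sign of curvature, so one set of estimates on `height`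
serves both bounding curves. -/
lemma side_eq_neg_height {a b : Arc} (h : b.start = a.start) (hd : b.dir = third * a.dir) (x : ℂ) :
    b.side (a.start + a.dir * x) = -height (-b.curv) ((starRingEnd ℂ) x * third) := by
  have : a.start + a.dir * x = b.start + b.dir * ((starRingEnd ℂ) third * x) := by
    rw [h, hd, show third * a.dir * ((starRingEnd ℂ) third * x)
      = third * (starRingEnd ℂ) third * (a.dir * x) by ring, third_mul_conj, one_mul]
  rw [this, side_start_add, height]
  simp only [Complex.normSq_mul, Complex.normSq_conj, normSq_third]
  simp
  ring

/-- Moving along the bisector raises the linear part of `height` at rate `√3 / 2`. The increment is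
`τ/2` times `√3` minus a curvature term of size at most `5 |k| r ≤ 1/2`. -/
lemma height_le_height_add {k r τ : ℝ} {x : ℂ} (hx : ‖x‖ ≤ r) (h0 : 0 ≤ τ) (h1 : τ ≤ 3 * r)
    (hk : |k| * r ≤ 1 / 10) : height k x ≤ height k (x + τ * bisector) := by
  have h3 : √3 * √3 = 3 := Real.mul_self_sqrt (by norm_num)
  have hc : 1 ≤ √3 := by rw [Real.one_le_sqrt]; norm_num
  have hr : 0 ≤ r := (norm_nonneg x).trans hx
  have hdiff : height k (x + τ * bisector) - height k x
      = τ / 2 * (√3 - k * (2 * (x * (starRingEnd ℂ) bisector).re + τ)) := by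
    simp [height, Complex.normSq_apply, bisector]
    linear_combination (-(k * τ ^ 2 / 8)) * h3
  have hre : |(x * (starRingEnd ℂ) bisector).re| ≤ r := by
    refine (Complex.abs_re_le_norm _).trans ?_
    rw [norm_mul, Complex.norm_conj, norm_bisector, mul_one]
    exact hx
  have hb : |2 * (x * (starRingEnd ℂ) bisector).re + τ| ≤ 5 * r := by
    rw [abs_le] at hre ⊢
    constructor <;> linarith [hre.1, hre.2]
  have hkb : k * (2 * (x * (starRingEnd ℂ) bisector).re + τ) ≤ |k| * (5 * r) :=
    (le_abs_self _).trans (by rw [abs_mul]; exact mul_le_mul_of_nonneg_left hb (abs_nonneg k))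
  have : 0 ≤ τ / 2 * (√3 - k * (2 * (x * (starRingEnd ℂ) bisector).re + τ)) :=
    mul_nonneg (by linarith) (by linarith)
  linarith

lemma norm_add_bisector_le {r τ : ℝ} {x : ℂ} (hx : ‖x‖ ≤ r) (h0 : 0 ≤ τ) :
    ‖x + τ * bisector‖ ≤ r + τ := by
  refine (norm_add_le _ _).trans ?_
  rw [norm_mul, norm_bisector, mul_one, Complex.norm_real, Real.norm_of_nonneg h0]
  linarith

/-- After a shift by `3r` the imaginary part is at least `(3√3/2 - 1) r > 1.5 r`, while the point
has norm at most `4r`, so the quadratic term is at most `0.8 r`. -/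
lemma height_pos {k r : ℝ} {x : ℂ} (hr : 0 < r) (hx : ‖x‖ ≤ r) (hk : |k| * r ≤ 1 / 10) :
    0 < height k (x + (3 * r : ℝ) * bisector) := by
  have hc : 17 / 10 ≤ √3 := Real.le_sqrt_of_sq_le (by norm_num)
  have hn := norm_add_bisector_le (τ := 3 * r) hx (by linarith)
  set y := x + (3 * r : ℝ) * bisector with hy
  have him : y.im = x.im + 3 * r * (√3 / 2) := by simp [hy, bisector]
  have h1 : -r ≤ x.im := by
    have := (abs_le.1 ((Complex.abs_im_le_norm x).trans hx)).1
    exact this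
  have h2 : Complex.normSq y ≤ 16 * r ^ 2 := by
    rw [Complex.normSq_eq_norm_sq]
    nlinarith [norm_nonneg y]
  have h3 : k / 2 * Complex.normSq y ≤ |k| / 2 * (16 * r ^ 2) :=
    mul_le_mul (by linarith [le_abs_self k]) h2 (Complex.normSq_nonneg _) (by positivity)
  have h4 : |k| / 2 * (16 * r ^ 2) ≤ 8 / 10 * r := by nlinarith
  rw [height, him]
  nlinarith

/-- Two curves that leave a vertex at the angle `2 π / 3` bound a connected sector there. -/
lemma exists_radius_sector {a b : Arc} (h : b.start = a.start) (hd : b.dir = third * a.dir)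
    {F : Set ℂ} {ρ : ℝ} (hρ : 0 < ρ)
    (hF : ∀ z ∈ Metric.ball a.start ρ, 0 < a.side z → b.side z < 0 → z ∉ F) :
    ∃ r > 0, ∀ z ∈ Metric.ball a.start r, ∀ z' ∈ Metric.ball a.start r,
      0 < a.side z → b.side z < 0 → 0 < a.side z' → b.side z' < 0 →
        connectedComponentIn Fᶜ z = connectedComponentIn Fᶜ z' := by
  -- All points used below lie within `4r` of the vertex, hence strictly inside radius `ρ`; the
  -- curvature bounds are those of the `height` estimates.
  obtain ⟨r, hr, hrρ, hra, hrb⟩ :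
      ∃ r > 0, 5 * r ≤ ρ ∧ |a.curv| * r ≤ 1 / 10 ∧ |-b.curv| * r ≤ 1 / 10 := by
    have hM : 0 < |a.curv| + |-b.curv| + 1 := by positivity
    refine ⟨min (ρ / 5) (1 / (10 * (|a.curv| + |-b.curv| + 1))), by positivity, ?_, ?_, ?_⟩
    · linarith [min_le_left (ρ / 5) (1 / (10 * (|a.curv| + |-b.curv| + 1)))]
    all_goals
      refine (mul_le_mul_of_nonneg_left (min_le_right _ _) (abs_nonneg _)).trans ?_
      rw [mul_one_div, div_le_div_iff₀ (by positivity) (by norm_num)]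
      linarith [abs_nonneg a.curv, abs_nonneg (-b.curv)]
  refine ⟨r, hr, ?_⟩
  have hnormc : ∀ x : ℂ, ‖(starRingEnd ℂ) x * third‖ = ‖x‖ := fun x => by
    rw [norm_mul, norm_third, Complex.norm_conj, mul_one]
  have hreflect : ∀ (x : ℂ) (τ : ℝ), (starRingEnd ℂ) (x + τ * bisector) * third
      = (starRingEnd ℂ) x * third + τ * bisector := fun x τ => by
    rw [map_add, map_mul, Complex.conj_ofReal, add_mul, mul_assoc, conj_bisector_mul_third]
  have hball : ∀ {x : ℂ} {τ : ℝ}, ‖x‖ ≤ r → 0 ≤ τ → τ ≤ 3 * r →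
      a.start + a.dir * (x + τ * bisector) ∈ Metric.ball a.start ρ := by
    intro x τ hx h0 h1
    rw [Metric.mem_ball, dist_eq_norm, add_sub_cancel_left, norm_mul, a.norm_dir, one_mul]
    linarith [norm_add_bisector_le hx h0]
  -- The disk of radius `r` shifted by `3r` along the bisector lies wholly inside the sector and
  -- serves as a common meeting place.
  have hpre : IsPreconnected ((fun y : ℂ => a.start + a.dir * (y + (3 * r : ℝ) * bisector)) ''
      Metric.closedBall 0 r) :=
    (convex_closedBall (0 : ℂ) r).isPreconnected.image _ (by fun_prop)
  have hsub : (fun y : ℂ => a.start + a.dir * (y + (3 * r : ℝ) * bisector)) ''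
      Metric.closedBall 0 r ⊆ Fᶜ := by
    rintro _ ⟨y, hy, rfl⟩
    rw [mem_closedBall_zero_iff] at hy
    refine hF _ (hball hy (by linarith) le_rfl) ?_ ?_
    · rw [side_eq_height]; exact height_pos hr hy hra
    · rw [side_eq_neg_height h hd, hreflect, neg_lt_zero]
      exact height_pos hr (by rwa [hnormc]) hrb
  -- Sliding a point of the sector along the bisector keeps it in the sector and ends in the shifted
  -- disk; all components are compared with that of the disk's center.
  have hmove : ∀ z ∈ Metric.ball a.start r, 0 < a.side z → b.side z < 0 →
      connectedComponentIn Fᶜ z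
        = connectedComponentIn Fᶜ (a.start + a.dir * (3 * r : ℝ) * bisector) := by
    intro z hz hza hzb
    obtain ⟨x, rfl⟩ : ∃ x, z = a.start + a.dir * x := by
      refine ⟨(starRingEnd ℂ) a.dir * (z - a.start), ?_⟩
      rw [← mul_assoc, a.dir_mul_conj]; ring
    have hx : ‖x‖ ≤ r := by
      rw [Metric.mem_ball, dist_eq_norm, add_sub_cancel_left, norm_mul, a.norm_dir, one_mul] at hz
      exact hz.le
    rw [side_eq_height] at hza
    rw [side_eq_neg_height h hd, neg_lt_zero] at hzb
    have hseg : IsPreconnected ((fun τ : ℝ => a.start + a.dir * (x + τ * bisector)) ''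
        Icc 0 (3 * r)) := isPreconnected_Icc.image _ (by fun_prop)
    have hsegsub : (fun τ : ℝ => a.start + a.dir * (x + τ * bisector)) '' Icc 0 (3 * r) ⊆ Fᶜ := by
      rintro _ ⟨τ, hτ, rfl⟩
      refine hF _ (hball hx hτ.1 hτ.2) ?_ ?_
      · rw [side_eq_height]
        exact hza.trans_le (height_le_height_add hx hτ.1 hτ.2 hra)
      · rw [side_eq_neg_height h hd, hreflect, neg_lt_zero]
        exact hzb.trans_le (height_le_height_add (by rwa [hnormc]) hτ.1 hτ.2 hrb)
    have e1 := connectedComponentIn_eq (hseg.subset_connectedComponentIn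
      ⟨0, left_mem_Icc.2 (by linarith), rfl⟩ hsegsub
      ⟨3 * r, right_mem_Icc.2 (by linarith), rfl⟩)
    have e2 := connectedComponentIn_eq (hpre.subset_connectedComponentIn
      ⟨x, mem_closedBall_zero_iff.2 hx, rfl⟩ hsub ⟨0, Metric.mem_closedBall_self hr.le, rfl⟩)
    have e3 := e1.trans e2
    simpa [mul_assoc] using e3
  intro z hz z' hz' h1 h2 h3 h4
  rw [hmove z hz h1 h2, hmove z' hz' h3 h4]

lemma eventually_pos_of_hasDerivAt {f : ℝ → ℝ} {c : ℝ} (hf : HasDerivAt f c 0) (h0 : f 0 = 0)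
    (hc : 0 < c) : ∀ᶠ s in 𝓝[>] 0, 0 < f s := by
  filter_upwards [hf.tendsto_slope_zero_right.eventually (lt_mem_nhds hc), self_mem_nhdsWithin]
    with s hs hs0
  rw [zero_add, h0, sub_zero, smul_eq_mul] at hs
  exact (pos_iff_pos_of_mul_pos hs).1 (inv_pos.2 hs0)

lemma hasDerivAt_side_point {a b : Arc} (h : b.start = a.start) :
    HasDerivAt (fun s => b.side (a.point s)) (a.dir * (starRingEnd ℂ) b.dir).im 0 := by
  have hp : HasDerivAt (fun s => a.point s - b.start) a.dir 0 := by
    simpa using (a.hasDerivAt_point 0).sub_const b.start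
  have h0 : a.point 0 - b.start = 0 := by rw [point_zero, h, sub_self]
  have h1 := Complex.imCLM.hasFDerivAt.comp_hasDerivAt 0 (hp.mul_const ((starRingEnd ℂ) b.dir))
  have hre := Complex.reCLM.hasFDerivAt.comp_hasDerivAt 0 hp
  have him := Complex.imCLM.hasFDerivAt.comp_hasDerivAt 0 hp
  have h2 := h1.sub (((hre.mul hre).add (him.mul him)).const_mul (b.curv / 2))
  refine (h2.congr_deriv ?_)
  simp [h]

lemma eventually_side_point_pos {a b : Arc} (h : b.start = a.start)
    (hc : 0 < (a.dir * (starRingEnd ℂ) b.dir).im) : ∀ᶠ s in 𝓝[>] 0, 0 < b.side (a.point s) :=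
  eventually_pos_of_hasDerivAt (hasDerivAt_side_point h) (by simp [← h, side]) hc

lemma eventually_side_point_neg {a b : Arc} (h : b.start = a.start)
    (hc : (a.dir * (starRingEnd ℂ) b.dir).im < 0) : ∀ᶠ s in 𝓝[>] 0, b.side (a.point s) < 0 := by
  filter_upwards [eventually_pos_of_hasDerivAt (hasDerivAt_side_point h).neg
    (by simp [← h, side]) (neg_pos.2 hc)] with s hs
  exact neg_pos.1 hs

/-- Near its start, a curve that starts to the right of another one stays there. -/
lemma eventually_side_nonpos_of_mem_carrier {a b : Arc} (h : b.start = a.start)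
    (hc : (a.dir * (starRingEnd ℂ) b.dir).im < 0) :
    ∀ᶠ z in 𝓝 a.start, z ∈ a.carrier → b.side z ≤ 0 := by
  obtain ⟨δ, hδ, hs⟩ := mem_nhdsGT_iff_exists_Ioo_subset.1 (eventually_side_point_neg h hc)
  have hδ' : (0 : ℝ) < δ := hδ
  -- The rest of the curve is compact and does not return to the start, so close to the vertex only
  -- parameters below `δ` occur.
  have hK : IsClosed (a.point '' Icc δ a.len) := (isCompact_Icc.image a.continuous_point).isClosed
  have hv : a.start ∉ a.point '' Icc δ a.len := by
    rintro ⟨t, ht, he⟩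
    rw [← point_zero] at he
    exact point_ne ⟨hδ'.le.trans ht.1, ht.2⟩ (left_mem_Icc.2 a.len_pos.le)
      (hδ'.trans_le ht.1).ne' he
  filter_upwards [hK.isOpen_compl.mem_nhds hv] with z hz hza
  obtain ⟨t, ht, rfl⟩ := hza
  rcases ht.1.eq_or_lt with h0 | h0
  · rw [← h0, point_zero, ← h]
    simp [side]
  · by_cases hlt : t < δ
    · exact le_of_lt (hs ⟨h0, hlt⟩)
    · exact absurd ⟨t, ⟨not_lt.1 hlt, ht.2⟩, rfl⟩ hz

lemma im_dir_mul_conj (a : Arc) (w : ℂ) : (w * a.dir * (starRingEnd ℂ) a.dir).im = w.im := by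
  rw [mul_assoc, a.dir_mul_conj, mul_one]

/-- Of three curves that meet at a vertex, the region to the left of one of them is, near the
vertex, the region to the right of the next one. -/
lemma eventually_left_eq_right {a b c : Arc} (hb : b.start = a.start) (hc : c.start = a.start)
    (hab : b.dir = third * a.dir) (hbc : c.dir = third * b.dir) {F : Set ℂ}
    (hF : ∀ᶠ z in 𝓝 a.start, z ∈ F → z ∈ a.carrier ∨ z ∈ b.carrier ∨ z ∈ c.carrier) :
    ∀ᶠ s : ℝ in 𝓝[>] 0, ∀ᶠ ε : ℝ in 𝓝[>] 0,
      connectedComponentIn Fᶜ (a.point s + ε * a.leftNormal s)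
        = connectedComponentIn Fᶜ (b.point s - ε * b.leftNormal s) := by
  -- The third curve leaves to the right of `a`, since `third * third` is the conjugate of `third`;
  -- hence it does not enter the sector between `a` and `b`.
  have hca : (c.dir * (starRingEnd ℂ) a.dir).im < 0 := by
    rw [hbc, hab, ← mul_assoc, third_mul_third, im_dir_mul_conj]
    simp [third]
  have hba : 0 < (b.dir * (starRingEnd ℂ) a.dir).im := by
    rw [hab, im_dir_mul_conj]
    simp [third]
  have hab' : (a.dir * (starRingEnd ℂ) b.dir).im < 0 := by
    rw [← neg_pos, ← Complex.conj_im, map_mul, Complex.conj_conj, mul_comm]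
    exact hba
  have hG := eventually_side_nonpos_of_mem_carrier hc.symm hca
  rw [hc] at hG
  obtain ⟨ρ, hρ, hball⟩ := Metric.eventually_nhds_iff_ball.1 (hF.and hG)
  obtain ⟨r, hr, hcomp⟩ := exists_radius_sector hb hab hρ (F := F) (by
    intro z hz h1 h2 hzF
    rcases (hball z hz).1 hzF with h | h | h
    · exact h1.ne' (side_eq_zero_of_mem_carrier h)
    · exact h2.ne (side_eq_zero_of_mem_carrier h)
    · exact absurd ((hball z hz).2 h) (not_le.2 h1))
  have near : ∀ d : Arc, d.start = a.start →
      ∀ᶠ s : ℝ in 𝓝[>] 0, d.point s ∈ Metric.ball a.start r := by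
    intro d hd
    have : Tendsto d.point (𝓝 0) (𝓝 a.start) := by
      have := d.continuous_point.tendsto 0
      rwa [point_zero, hd] at this
    exact nhdsWithin_le_nhds (this.eventually (Metric.ball_mem_nhds _ hr))
  filter_upwards [near a rfl, near b hb, eventually_side_point_neg hb hab',
    eventually_side_point_pos hb.symm hba] with s ha' hb' hs1 hs2
  have tb : Tendsto (fun ε : ℝ => b.point s - ε * b.leftNormal s) (𝓝[>] 0) (𝓝 (b.point s)) := by
    simpa [sub_eq_add_neg] using tendsto_normal (b.point s) (-b.leftNormal s)
  have ta := tendsto_normal (a.point s) (a.leftNormal s)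
  filter_upwards [a.eventually_side_left_pos s, b.eventually_side_right_neg s,
    ta.eventually (Metric.isOpen_ball.mem_nhds ha'),
    tb.eventually (Metric.isOpen_ball.mem_nhds hb'),
    ta.eventually (b.continuous_side.continuousAt.eventually (gt_mem_nhds hs1)),
    tb.eventually (a.continuous_side.continuousAt.eventually (lt_mem_nhds hs2))]
    with ε h1 h2 h4 h5 h6 h7
  exact hcomp _ h4 _ h5 h1 h6 h7 h2

end Arc

/-! ### Pressures around a vertex: the curvatures balance -/

variable {ι : Type*}

/-- The Young--Laplace equation along a curve that starts at one of its ends. -/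
lemma YoungLaplace.outward {σ : ℝ} {A : ι → Arc} {p : Bubble A → ℝ} (hp : YoungLaplace σ A p)
    (e : ι × Bool) {s : ℝ} (hs : s ∈ Ioo 0 (A e.1).len) : ∃ L R : Bubble A,
      (∀ᶠ ε : ℝ in 𝓝[>] 0, ((A e.1).outward e.2).point s
        + ε * ((A e.1).outward e.2).leftNormal s ∈ L.1) ∧
      (∀ᶠ ε : ℝ in 𝓝[>] 0, ((A e.1).outward e.2).point s
        - ε * ((A e.1).outward e.2).leftNormal s ∈ R.1) ∧
      p L - p R = -(σ * (A e.1).signedCurvature e.2) := by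
  obtain ⟨i, b⟩ := e
  cases b
  · obtain ⟨L, R, hL, hR, h⟩ := hp i s hs
    exact ⟨L, R, hL, hR, by simp [Arc.signedCurvature, h]⟩
  · obtain ⟨L, R, hL, hR, h⟩ := hp i ((A i).len - s) ⟨by linarith [hs.2], by linarith [hs.1]⟩
    refine ⟨R, L, ?_, ?_, by simp only [Arc.signedCurvature]; linarith⟩
    · simpa [IsRightBubble, Arc.outward, Arc.leftNormal, Arc.reverse_point, Arc.reverse_tangent,
        sub_eq_add_neg] using hR
    · simpa [IsLeftBubble, Arc.outward, Arc.leftNormal, Arc.reverse_point, Arc.reverse_tangent,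
        sub_eq_add_neg] using hL

/-- Near a vertex there are only the curves that end there. -/
lemma PlateauLaws.eventually_mem_carrier [Fintype ι] {A : ι → Arc} (hA : PlateauLaws A) {v : ℂ}
    {e : ι × Bool} (he : e ∈ endsAt A v) :
    ∀ᶠ z in 𝓝 v, z ∈ figure A → ∃ f ∈ endsAt A v, z ∈ (A f.1).carrier := by
  classical
  have hmem : ∀ f : ι × Bool, f ∈ endsAt A v ↔ (A f.1).endpoint f.2 = v := fun f => by
    simp [endsAt]
  have : ∀ j, ∀ᶠ z in 𝓝 v, z ∈ (A j).carrier → ∃ f ∈ endsAt A v, z ∈ (A f.1).carrier := by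
    intro j
    by_cases hj : ∃ b, (j, b) ∈ endsAt A v
    · obtain ⟨b, hb⟩ := hj
      exact Eventually.of_forall fun z hz => ⟨_, hb, hz⟩
    -- A curve with no end at `v` cannot pass through `v`, because it would meet the curve of `e`
    -- outside its own endpoints.
    · have hv : v ∉ (A j).carrier := by
        intro hv
        have hne : e.1 ≠ j := by
          rintro rfl
          exact hj ⟨e.2, he⟩
        have hve : v ∈ (A e.1).carrier := by
          rw [← (hmem e).1 he, ← Arc.outward_carrier _ e.2, ← Arc.outward_start,
            ← Arc.point_zero]
          exact ⟨0, left_mem_Icc.2 (Arc.len_pos _).le, rfl⟩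
        obtain ⟨b, hb⟩ := (hA.noncrossing e.1 j hne ⟨hve, hv⟩).2
        exact hj ⟨b, (hmem _).2 hb⟩
      filter_upwards [(A j).isCompact_carrier.isClosed.isOpen_compl.mem_nhds hv] with z hz hz'
      exact absurd hz' hz
  filter_upwards [eventually_all.2 this] with z hz hzF
  obtain ⟨j, hj⟩ := mem_iUnion.1 hzF
  exact hz j hj

/-- Around a vertex, the pressure differences add up to zero. -/
lemma YoungLaplace.sum_eq_zero [Fintype ι] {σ : ℝ} {A : ι → Arc} {p : Bubble A → ℝ}
    (hp : YoungLaplace σ A p) (hσ : σ ≠ 0) {v : ℂ} (e : Fin 3 → ι × Bool)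
    (he : ∀ k, (A (e k).1).endpoint (e k).2 = v)
    (hdir : ∀ k, (A (e (k + 1)).1).outgoing (e (k + 1)).2
      = Arc.third * (A (e k).1).outgoing (e k).2)
    (hF : ∀ᶠ z in 𝓝 v, z ∈ figure A → ∃ k, z ∈ (A (e k).1).carrier) :
    ∑ k, (A (e k).1).signedCurvature (e k).2 = 0 := by
  set a : Fin 3 → Arc := fun k => (A (e k).1).outward (e k).2 with ha
  have hstart : ∀ k, (a k).start = v := fun k => by rw [ha, Arc.outward_start, he]
  have hd : ∀ k, (a (k + 1)).dir = Arc.third * (a k).dir := fun k => by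
    simp only [ha, Arc.outward_dir, hdir]
  have hadj : ∀ k, ∀ᶠ s : ℝ in 𝓝[>] 0, ∀ᶠ ε : ℝ in 𝓝[>] 0,
      connectedComponentIn (figure A)ᶜ ((a k).point s + ε * (a k).leftNormal s)
        = connectedComponentIn (figure A)ᶜ
          ((a (k + 1)).point s - ε * (a (k + 1)).leftNormal s) := by
    intro k
    refine Arc.eventually_left_eq_right (c := a (k + 1 + 1)) (by rw [hstart, hstart])
      (by rw [hstart, hstart]) (hd k) (hd (k + 1)) ?_
    rw [hstart]
    filter_upwards [hF] with z hz hzF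
    obtain ⟨l, hl⟩ := hz hzF
    rw [← Arc.outward_carrier _ (e l).2] at hl
    have : l = k ∨ l = k + 1 ∨ l = k + 1 + 1 := by
      clear hl; decide +revert
    rcases this with rfl | rfl | rfl
    · exact Or.inl hl
    · exact Or.inr (Or.inl hl)
    · exact Or.inr (Or.inr hl)
  have hlen : ∀ k, ∀ᶠ s : ℝ in 𝓝[>] 0, s ∈ Ioo 0 (A (e k).1).len := fun k =>
    Ioo_mem_nhdsGT (Arc.len_pos _)
  -- One arc length `s` works for all three curves; the normal offset `ε` is chosen afterwards,
  -- depending on `s`.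
  obtain ⟨s, hs1, hs2⟩ := ((eventually_all.2 hadj).and (eventually_all.2 hlen)).exists
  choose L R hL hR hLR using fun k => hp.outward (e k) (hs2 k)
  have hbub : ∀ k, L k = R (k + 1) := by
    intro k
    obtain ⟨ε, ⟨h1, h2⟩, h3⟩ := (((hL k).and (hR (k + 1))).and (hs1 k)).exists
    exact Subtype.ext (((L k).eq_connectedComponentIn h1).trans
      (h3.trans ((R (k + 1)).eq_connectedComponentIn h2).symm))
  -- Addition in `Fin 3` is cyclic, so the right bubbles are the left bubbles shifted by one.
  have hsum : ∑ k, (p (L k) - p (R k)) = 0 := by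
    rw [Finset.sum_sub_distrib, ← Equiv.sum_comp (Equiv.addRight (1 : Fin 3)) fun k => p (R k)]
    simp [hbub]
  simp only [hLR, Finset.sum_neg_distrib, ← Finset.mul_sum, neg_eq_zero] at hsum
  exact (mul_eq_zero.1 hsum).resolve_left hσ

/-- The unoriented angle fixes only the real part `-1/2` of the unit number `y * conj x`, leaving
the two primitive cube roots of unity. -/
lemma eq_third_mul_or {x y : ℂ} (hx : ‖x‖ = 1) (hy : ‖y‖ = 1)
    (h : InnerProductGeometry.angle x y = 2 * Real.pi / 3) :
    y = Arc.third * x ∨ x = Arc.third * y := by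
  have h3 : √3 * √3 = 3 := Real.mul_self_sqrt (by norm_num)
  have hin : (y * (starRingEnd ℂ) x).re = -1 / 2 := by
    rw [← Complex.inner, ← InnerProductGeometry.cos_angle_mul_norm_mul_norm, h, hx, hy,
      show 2 * Real.pi / 3 = Real.pi - Real.pi / 3 by ring, Real.cos_pi_sub, Real.cos_pi_div_three]
    norm_num
  have hxx : x * (starRingEnd ℂ) x = 1 := by
    rw [Complex.mul_conj, Complex.normSq_eq_norm_sq, hx]; norm_num
  set w := y * (starRingEnd ℂ) x with hw
  have hyw : y = w * x := by
    rw [hw, mul_right_comm, mul_assoc, hxx, mul_one]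
  have hn : w.re * w.re + w.im * w.im = 1 := by
    rw [← Complex.normSq_apply, hw, Complex.normSq_mul, Complex.normSq_conj,
      Complex.normSq_eq_norm_sq, Complex.normSq_eq_norm_sq, hx, hy]
    norm_num
  have him : (w.im - √3 / 2) * (w.im + √3 / 2) = 0 := by
    rw [hin] at hn
    linear_combination hn - h3 / 4
  rcases mul_eq_zero.1 him with h1 | h1
  · left
    rw [hyw]
    congr 1
    exact Complex.ext hin (by simp only [Arc.third]; linarith)
  · right
    have hwc : w = (starRingEnd ℂ) Arc.third :=
      Complex.ext (by simp [hin, Arc.third]) (by simp [Arc.third]; linarith)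
    rw [hyw, hwc, ← mul_assoc, Arc.third_mul_conj, one_mul]

lemma Arc.norm_outgoing (a : Arc) (b : Bool) : ‖a.outgoing b‖ = 1 := by
  rw [← a.outward_dir, Arc.norm_dir]

lemma Arc.eq_third_mul_iff {x y : ℂ} : x = third * y ↔ y = third * (third * x) := by
  have h : third * (third * third) = 1 := by rw [third_mul_third, third_mul_conj]
  constructor
  · rintro rfl
    rw [← mul_assoc, ← mul_assoc, mul_assoc third third third, h, one_mul]
  · intro hy
    rw [hy, ← mul_assoc, ← mul_assoc, mul_assoc third third third, h, one_mul]

/-- The curves that meet at a vertex can be listed in counterclockwise order. -/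
lemma PlateauLaws.exists_enumeration [Fintype ι] {A : ι → Arc} (hA : PlateauLaws A) {v : ℂ}
    (hcard : (endsAt A v).card = 3) : ∃ e : Fin 3 → ι × Bool,
      (∀ f : ι × Bool, f ∈ endsAt A v ↔ ∃ k, e k = f) ∧ Function.Injective e ∧
      ∀ k, (A (e (k + 1)).1).outgoing (e (k + 1)).2
        = Arc.third * (A (e k).1).outgoing (e k).2 := by
  classical
  obtain ⟨x, y, z, hxy, hxz, hyz, hs⟩ := Finset.card_eq_three.1 hcard
  have key : ∀ x y z : ι × Bool, x ≠ y → x ≠ z → y ≠ z → endsAt A v = {x, y, z} →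
      (A y.1).outgoing y.2 = Arc.third * (A x.1).outgoing x.2 →
      ∃ e : Fin 3 → ι × Bool,
      (∀ f : ι × Bool, f ∈ endsAt A v ↔ ∃ k, e k = f) ∧ Function.Injective e ∧
      ∀ k, (A (e (k + 1)).1).outgoing (e (k + 1)).2
        = Arc.third * (A (e k).1).outgoing (e k).2 := by
    intro x y z hxy hxz hyz hs h1
    have hyz' := hA.angles v y (by simp [hs]) z (by simp [hs]) hyz
    have hxz' := hA.angles v x (by simp [hs]) z (by simp [hs]) hxz
    have h2 : (A z.1).outgoing z.2 = Arc.third * (A y.1).outgoing y.2 := by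
      rcases eq_third_mul_or (Arc.norm_outgoing _ _) (Arc.norm_outgoing _ _) hyz' with h | h
      · exact h
      -- Otherwise `x` and `z` would leave in the same direction, at angle `0` instead of `2π/3`.
      · exfalso
        have hxeq : (A x.1).outgoing x.2 = (A z.1).outgoing z.2 := by
          have ht : Arc.third ≠ 0 := fun h0 => by simpa [h0] using Arc.norm_third
          exact mul_left_cancel₀ ht (h1.symm.trans h)
        rw [hxeq, InnerProductGeometry.angle_self (by
          rw [← norm_ne_zero_iff, Arc.norm_outgoing]; exact one_ne_zero)] at hxz'
        linarith [Real.pi_pos]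
    have h3 : (A x.1).outgoing x.2 = Arc.third * (A z.1).outgoing z.2 := by
      rw [Arc.eq_third_mul_iff, ← h1, h2]
    refine ⟨![x, y, z], ?_, ?_, ?_⟩
    · intro f
      simp [hs, Fin.exists_fin_succ, eq_comm]
    · intro k l hkl
      fin_cases k <;> fin_cases l <;>
        first
        | rfl
        | exact absurd hkl hxy
        | exact absurd hkl hxz
        | exact absurd hkl hyz
        | exact absurd hkl.symm hxy
        | exact absurd hkl.symm hxz
        | exact absurd hkl.symm hyz
    · intro k
      fin_cases k
      · exact h1
      · exact h2
      · exact h3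
  have hxy' := hA.angles v x (by simp [hs]) y (by simp [hs]) hxy
  rcases eq_third_mul_or (Arc.norm_outgoing _ _) (Arc.norm_outgoing _ _) hxy' with h | h
  · exact key x y z hxy hxz hyz hs h
  -- If `x`, `y` are in clockwise order, exchanging them restores the counterclockwise order.
  · exact key y x z hxy.symm hyz hxz (by rw [hs]; ext; simp; tauto) h

theorem YoungLaplace.balanced [Fintype ι] {σ : ℝ} {A : ι → Arc} {p : Bubble A → ℝ}
    (hp : YoungLaplace σ A p) (hσ : σ ≠ 0) (hA : PlateauLaws A) : Balanced A := by
  classical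
  intro i b
  obtain ⟨e, hmem, hinj, hdir⟩ := hA.exists_enumeration (hA.three_meet i b)
  have himg : endsAt A ((A i).endpoint b) = Finset.univ.image e := by
    ext f; simp [hmem]
  rw [himg, Finset.sum_image fun _ _ _ _ h => hinj h]
  refine hp.sum_eq_zero hσ (v := (A i).endpoint b) e (fun k => ?_) hdir ?_
  · have := (hmem (e k)).2 ⟨k, rfl⟩
    simpa [endsAt] using this
  · have h0 : (i, b) ∈ endsAt A ((A i).endpoint b) := by simp [endsAt]
    filter_upwards [hA.eventually_mem_carrier h0] with z hz hzF
    obtain ⟨f, hf, hzf⟩ := hz hzF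
    obtain ⟨k, rfl⟩ := (hmem f).1 hf
    exact ⟨k, hzf⟩

end SoapBubble

theorem mainTheorem2 {ι : Type*} [Fintype ι] (A : ι → SoapBubble.Arc) (σ : ℝ) (hσ : 0 < σ) :
    SoapBubble.IsSoapBubbleCluster σ A ↔
      SoapBubble.PlateauLaws A ∧
        ∀ (i : ι) (b : Bool),
          ∑ e ∈ SoapBubble.endsAt A ((A i).endpoint b), (A e.1).signedCurvature e.2 = 0 := by
  constructor
  · rintro ⟨hA, p, hp⟩
    exact ⟨hA, hp.balanced hσ.ne' hA⟩
  · rintro ⟨hA, h⟩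
    exact ⟨hA, SoapBubble.Balanced.exists_youngLaplace h hA σ⟩
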